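/- Let $n\ge 1$ and let $\mathcal D(n)=\{\rho\in\mathbb C^{n\times n}:\rho \text{ is Hermitian positive definite and } \operatorname{tr}\rho=1\}$, regarded as a smooth manifold (an open convex subset of the real affine space of Hermitian matrices with trace one), whose tangent space at each point is identified with the real vector space of traceless Hermitian matrices. For positive definite $\Sigma$ and Hermitian $H$ let $\mathcal L_\Sigma(H)$ be the unique matrix $X$ with $X\Sigma+\Sigma X=H$. Equip $\mathcal D(n)$ with the restriction of the Bures–Wasserstein metric, that is, with the Riemannian metric $$\mathfrak g^{BW}_\rho(H,K)=\tfrac12\operatorname{Re}\operatorname{tr}\big(\mathcal L_\rho(H)\,K\big),\qquad H,K\ \text{traceless Hermitian}.$$ Then for all $\rho_1,\rho_2\in\mathcal D(n)$ the Riemannian distance on $\mathcal D(n)$, i.e. the infimum of the $\mathfrak g^{BW}$-lengths $\int_0^1 \mathfrak g^{BW}_{\gamma(t)}(\gamma'(t),\gamma'(t))^{1/2}\,dt$ of $C^1$ curves $\gamma:[0,1]\to\mathcal D(n)$ with $\gamma(0)=\rho_1$ and $\gamma(1)=\rho_2$, is $$d^{BW}_{\mathcal D(n)}(\rho_1,\rho_2)=\arccos\Big(\operatorname{Re}\operatorname{tr}\big((\rho_2^{1/2}\rho_1\rho_2^{1/2})^{1/2}\big)\Big).$$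 -/

import Mathlib

open scoped ComplexOrder MatrixOrder Manifold ContDiff Matrix Bundle

noncomputable section

namespace BuresWasserstein

/-! ### The Bures-Wasserstein form on positive definite matrices -/

/-- The solution `X` of the Lyapunov equation `X Σ + Σ X = H`
(for positive definite `Σ` it exists and is unique, see `existsUnique_lyapunov`). -/
def lyapunov {n : ℕ} (S H : Matrix (Fin n) (Fin n) ℂ) : Matrix (Fin n) (Fin n) ℂ :=
  Classical.epsilon fun X => X * S + S * X = H

/-- The Bures-Wasserstein metric at a positive definite matrix `Σ`, evaluated on Hermitian
tangent vectors `H` and `K`: one half of the real part of `tr (L_Σ(H) K)`. -/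
def bwForm {n : ℕ} (S H K : Matrix (Fin n) (Fin n) ℂ) : ℝ :=
  (1 / 2 : ℝ) * (Matrix.trace (lyapunov S H * K)).re

section Lyapunov

variable {n : ℕ} {S : Matrix (Fin n) (Fin n) ℂ}

lemma trace_conj_re_nonneg (hS : S.PosDef) (X : Matrix (Fin n) (Fin n) ℂ) :
    0 ≤ (Matrix.trace (X * S * Xᴴ)).re :=
  (Complex.le_def.1 (hS.posSemidef.mul_mul_conjTranspose_same X).trace_nonneg).1

lemma eq_zero_of_trace_conj (hS : S.PosDef) {X : Matrix (Fin n) (Fin n) ℂ}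
    (h : (Matrix.trace (X * S * Xᴴ)).re = 0) : X = 0 := by
  have hp := hS.posSemidef.mul_mul_conjTranspose_same X
  have h0 : X * S * Xᴴ = 0 := by
    rw [← hp.trace_eq_zero_iff]
    have := Complex.le_def.1 hp.trace_nonneg
    exact Complex.ext h (by simpa using this.2.symm)
  have hv : ∀ v : Fin n → ℂ, Xᴴ *ᵥ v = 0 := by
    intro v
    by_contra hne
    have := hS.dotProduct_mulVec_pos hne
    rw [Matrix.star_mulVec, Matrix.conjTranspose_conjTranspose, Matrix.mulVec_mulVec,
      ← Matrix.dotProduct_mulVec, Matrix.mulVec_mulVec, ← Matrix.mul_assoc, h0] at this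
    simp at this
  have : Xᴴ = 0 := by
    ext i j
    simpa using congrFun (hv (Pi.single j 1)) i
  simpa using this

lemma lyapunov_injective (hS : S.PosDef) {X : Matrix (Fin n) (Fin n) ℂ}
    (h : X * S + S * X = 0) : X = 0 := by
  have h1 : Matrix.trace (X * S * Xᴴ) + Matrix.trace (Xᴴ * S * Xᴴᴴ) = 0 := by
    rw [Matrix.conjTranspose_conjTranspose, Matrix.trace_mul_cycle Xᴴ S X,
      Matrix.mul_assoc X Xᴴ S, Matrix.trace_mul_comm X (Xᴴ * S), Matrix.mul_assoc Xᴴ S X,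
      Matrix.trace_mul_comm (X * S) Xᴴ, ← Matrix.trace_add, ← Matrix.mul_add, h]
    simp
  have h2 := congrArg Complex.re h1
  rw [Complex.add_re, Complex.zero_re] at h2
  have := trace_conj_re_nonneg hS X
  have := trace_conj_re_nonneg hS Xᴴ
  exact eq_zero_of_trace_conj hS (by linarith)

lemma existsUnique_lyapunov (hS : S.PosDef) (H : Matrix (Fin n) (Fin n) ℂ) :
    ∃! X, X * S + S * X = H := by
  let T : Matrix (Fin n) (Fin n) ℂ →ₗ[ℂ] Matrix (Fin n) (Fin n) ℂ :=
    LinearMap.mulRight ℂ S + LinearMap.mulLeft ℂ S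
  have hT : Function.Injective T :=
    (injective_iff_map_eq_zero T).2 fun X hX => lyapunov_injective hS hX
  obtain ⟨X, hX⟩ := LinearMap.injective_iff_surjective.1 hT H
  exact ⟨X, hX, fun Y hY => hT (hY.trans hX.symm)⟩

lemma lyapunov_spec (hS : S.PosDef) (H : Matrix (Fin n) (Fin n) ℂ) :
    lyapunov S H * S + S * lyapunov S H = H :=
  Classical.epsilon_spec (existsUnique_lyapunov hS H).exists

lemma lyapunov_eq (hS : S.PosDef) {H X : Matrix (Fin n) (Fin n) ℂ}
    (h : X * S + S * X = H) : lyapunov S H = X :=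
  (existsUnique_lyapunov hS H).unique (lyapunov_spec hS H) h

lemma lyapunov_add (hS : S.PosDef) (H K : Matrix (Fin n) (Fin n) ℂ) :
    lyapunov S (H + K) = lyapunov S H + lyapunov S K := by
  apply lyapunov_eq hS
  have h1 := lyapunov_spec hS H
  have h2 := lyapunov_spec hS K
  calc _ = (lyapunov S H * S + S * lyapunov S H) + (lyapunov S K * S + S * lyapunov S K) := by
        noncomm_ring
    _ = H + K := by rw [h1, h2]

lemma lyapunov_smul (hS : S.PosDef) (c : ℝ) (H : Matrix (Fin n) (Fin n) ℂ) :
    lyapunov S (c • H) = c • lyapunov S H := by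
  apply lyapunov_eq hS
  have h1 := lyapunov_spec hS H
  calc _ = c • (lyapunov S H * S + S * lyapunov S H) := by simp
    _ = c • H := by rw [h1]

lemma lyapunov_isHermitian (hS : S.PosDef) {H : Matrix (Fin n) (Fin n) ℂ} (hH : H.IsHermitian) :
    (lyapunov S H).IsHermitian := by
  refine (lyapunov_eq hS ?_).symm
  have := congrArg Matrix.conjTranspose (lyapunov_spec hS H)
  simp only [Matrix.conjTranspose_add, Matrix.conjTranspose_mul, hS.isHermitian.eq, hH.eq] at this
  rw [add_comm, this]

lemma bwForm_symm (hS : S.PosDef) (H K : Matrix (Fin n) (Fin n) ℂ) :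
    bwForm S H K = bwForm S K H := by
  have key : ∀ A B : Matrix (Fin n) (Fin n) ℂ,
      Matrix.trace (A * (B * S + S * B)) = Matrix.trace (B * (A * S + S * A)) := by
    intro A B
    rw [Matrix.mul_add, Matrix.mul_add, Matrix.trace_add, Matrix.trace_add,
      ← Matrix.mul_assoc B S A, Matrix.trace_mul_comm (B * S) A,
      ← Matrix.mul_assoc A S B, Matrix.trace_mul_comm (A * S) B, add_comm]
  have h := key (lyapunov S H) (lyapunov S K)
  rw [lyapunov_spec hS H, lyapunov_spec hS K] at h
  unfold bwForm
  rw [h]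

lemma bwForm_pos (hS : S.PosDef) {H : Matrix (Fin n) (Fin n) ℂ} (hH : H.IsHermitian)
    (h0 : H ≠ 0) : 0 < bwForm S H H := by
  set L := lyapunov S H with hL
  have hLh : Lᴴ = L := (lyapunov_isHermitian hS hH).eq
  have hspec : L * S + S * L = H := lyapunov_spec hS H
  have h1 : Matrix.trace (L * H) = Matrix.trace (L * S * Lᴴ) + Matrix.trace (L * S * Lᴴ) := by
    rw [hLh]
    calc Matrix.trace (L * H) = Matrix.trace (L * (L * S + S * L)) := by rw [hspec]
      _ = _ := ?_
    rw [Matrix.mul_add, Matrix.trace_add, Matrix.trace_mul_comm L (L * S), ← Matrix.mul_assoc]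
  have h2 := trace_conj_re_nonneg hS L
  have h3 : (Matrix.trace (L * S * Lᴴ)).re ≠ 0 := by
    intro h
    have := eq_zero_of_trace_conj hS h
    rw [this] at hspec
    exact h0 (by rw [← hspec]; simp)
  have h4 : 0 < (Matrix.trace (L * S * Lᴴ)).re := lt_of_le_of_ne h2 (Ne.symm h3)
  unfold bwForm
  rw [← hL, h1, Complex.add_re]
  linarith

end Lyapunov

/-! ### The manifold of trace-one positive definite matrices -/

/-- The real vector space of traceless Hermitian matrices. -/
def tracelessHermitian (n : ℕ) : Submodule ℝ (Matrix (Fin n) (Fin n) ℂ) where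
  carrier := {H | H.IsHermitian ∧ H.trace = 0}
  add_mem' := fun ⟨a, b⟩ ⟨c, d⟩ => ⟨a.add c, by simp [b, d]⟩
  zero_mem' := ⟨Matrix.isHermitian_zero, by simp⟩
  smul_mem' := fun c H ⟨a, b⟩ =>
    ⟨by simp [Matrix.IsHermitian, Matrix.conjTranspose_smul, a.eq], by simp [b]⟩

/-- The traceless Hermitian matrices as a type, used as the model space. -/
def TracelessHermitian (n : ℕ) : Type := tracelessHermitian n

instance (n : ℕ) : AddCommGroup (TracelessHermitian n) :=
  inferInstanceAs (AddCommGroup (tracelessHermitian n))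

instance (n : ℕ) : Module ℝ (TracelessHermitian n) :=
  inferInstanceAs (Module ℝ (tracelessHermitian n))

/-- The inclusion of the traceless Hermitian matrices into all matrices. -/
def TracelessHermitian.toMatrix {n : ℕ} :
    TracelessHermitian n →ₗ[ℝ] Matrix (Fin n) (Fin n) ℂ :=
  (tracelessHermitian n).subtype

lemma TracelessHermitian.toMatrix_injective {n : ℕ} :
    Function.Injective (TracelessHermitian.toMatrix (n := n)) :=
  Subtype.val_injective

section Instances

attribute [local instance] Matrix.frobeniusNormedAddCommGroup Matrix.frobeniusNormedSpace

/-- The Frobenius norm on traceless Hermitian matrices. -/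
instance (n : ℕ) : NormedAddCommGroup (TracelessHermitian n) :=
  NormedAddCommGroup.induced (TracelessHermitian n) (Matrix (Fin n) (Fin n) ℂ)
    TracelessHermitian.toMatrix TracelessHermitian.toMatrix_injective

instance (n : ℕ) : NormedSpace ℝ (TracelessHermitian n) :=
  NormedSpace.induced ℝ (TracelessHermitian n) (Matrix (Fin n) (Fin n) ℂ)
    TracelessHermitian.toMatrix

end Instances

instance (n : ℕ) : FiniteDimensional ℝ (TracelessHermitian n) :=
  FiniteDimensional.of_injective TracelessHermitian.toMatrix TracelessHermitian.toMatrix_injective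

/-- The set `D(n)` of positive definite Hermitian matrices with trace one,
with the subspace topology. -/
abbrev DensityMatrix (n : ℕ) : Type :=
  {ρ : Matrix (Fin n) (Fin n) ℂ // ρ.PosDef ∧ ρ.trace = 1}

section Chart

variable {n : ℕ}

lemma TracelessHermitian.isHermitian (H : TracelessHermitian n) : H.toMatrix.IsHermitian :=
  H.2.1

lemma TracelessHermitian.trace_eq_zero (H : TracelessHermitian n) : H.toMatrix.trace = 0 :=
  H.2.2

lemma TracelessHermitian.isEmbedding_toMatrix :
    Topology.IsEmbedding (TracelessHermitian.toMatrix (n := n)) :=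
  (LinearMap.isClosedEmbedding_of_injective
    (LinearMap.ker_eq_bot.2 TracelessHermitian.toMatrix_injective)).isEmbedding

/-- The maximally mixed state `I / n`, base point of the chart. -/
def center (n : ℕ) : Matrix (Fin n) (Fin n) ℂ := (n : ℝ)⁻¹ • 1

lemma center_posDef (n : ℕ) [NeZero n] : (center n).PosDef :=
  Matrix.PosDef.one.smul (by have := NeZero.pos n; positivity)

lemma center_trace (n : ℕ) [NeZero n] : (center n).trace = 1 := by
  simp [center]

instance [NeZero n] : Nonempty (DensityMatrix n) := ⟨⟨center n, center_posDef n, center_trace n⟩⟩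

variable [NeZero n]

/-- The global affine chart `ρ ↦ ρ - I / n` of `D(n)`. -/
def chartMap (ρ : DensityMatrix n) : TracelessHermitian n :=
  ⟨ρ.1 - center n, ρ.2.1.isHermitian.sub (center_posDef n).isHermitian, by
    rw [Matrix.trace_sub, ρ.2.2, center_trace, sub_self]⟩

lemma toMatrix_chartMap (ρ : DensityMatrix n) : (chartMap ρ).toMatrix = ρ.1 - center n := rfl

lemma range_chartMap :
    Set.range (chartMap (n := n)) = {H | (H.toMatrix + center n).PosDef} := by
  ext H
  constructor
  · rintro ⟨ρ, rfl⟩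
    simpa [toMatrix_chartMap] using ρ.2.1
  · intro h
    refine ⟨⟨H.toMatrix + center n, h, ?_⟩, ?_⟩
    · rw [Matrix.trace_add, H.trace_eq_zero, center_trace, zero_add]
    · apply TracelessHermitian.toMatrix_injective
      simp [toMatrix_chartMap]

lemma isOpen_posDef :
    IsOpen {H : TracelessHermitian n | (H.toMatrix + center n).PosDef} := by
  have hc : Continuous fun p : TracelessHermitian n × (Fin n → ℂ) =>
      (star p.2 ⬝ᵥ ((p.1.toMatrix + center n) *ᵥ p.2)).re := by
    have h1 : Continuous fun p : TracelessHermitian n × (Fin n → ℂ) =>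
      p.1.toMatrix + center n :=
      (TracelessHermitian.isEmbedding_toMatrix.continuous.comp continuous_fst).add
        continuous_const
    exact Complex.continuous_re.comp
      (Continuous.dotProduct (continuous_star.comp continuous_snd)
        (h1.matrix_mulVec continuous_snd))
  have hherm : ∀ H : TracelessHermitian n, (H.toMatrix + center n).IsHermitian := fun H =>
    H.isHermitian.add (center_posDef n).isHermitian
  rw [isOpen_iff_eventually]
  intro H hH
  have hK : IsCompact (Metric.sphere (0 : Fin n → ℂ) 1) := isCompact_sphere 0 1
  have key : ∀ᶠ H' in nhds H, ∀ x ∈ Metric.sphere (0 : Fin n → ℂ) 1,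
      0 < (star x ⬝ᵥ ((H'.toMatrix + center n) *ᵥ x)).re := by
    apply hK.eventually_forall_of_forall_eventually
    intro x hx
    have hx0 : x ≠ 0 := by
      rintro rfl
      simp at hx
    have hpos := (Complex.lt_def.1 (Matrix.PosDef.dotProduct_mulVec_pos hH hx0)).1
    exact hc.continuousAt.eventually (lt_mem_nhds hpos)
  filter_upwards [key] with H' h'
  refine Matrix.PosDef.of_dotProduct_mulVec_pos (hherm H') fun x hx => ?_
  have hre := h' ((‖x‖⁻¹ : ℝ) • x) (by
    simp [norm_smul, inv_mul_cancel₀ (norm_ne_zero_iff.2 hx)])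
  have hxn : 0 < ‖x‖⁻¹ := inv_pos.2 (norm_pos_iff.2 hx)
  rw [star_smul, Matrix.mulVec_smul, smul_dotProduct, dotProduct_smul] at hre
  simp only [star_trivial, Complex.real_smul, Complex.re_ofReal_mul] at hre
  have hre' : 0 < (star x ⬝ᵥ ((H'.toMatrix + center n) *ᵥ x)).re := by
    by_contra hneg
    rw [not_lt] at hneg
    have := mul_nonpos_of_nonneg_of_nonpos hxn.le
      (mul_nonpos_of_nonneg_of_nonpos hxn.le hneg)
    linarith
  have him := (hherm H').im_star_dotProduct_mulVec_self x
  exact Complex.lt_def.2 ⟨hre', by simpa using him.symm⟩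

lemma isOpenEmbedding_chartMap : Topology.IsOpenEmbedding (chartMap (n := n)) := by
  refine ⟨?_, by rw [range_chartMap]; exact isOpen_posDef⟩
  have h1 : Topology.IsEmbedding
      (TracelessHermitian.toMatrix ∘ chartMap : DensityMatrix n → _) :=
    (Homeomorph.subRight (center n)).isEmbedding.comp Topology.IsEmbedding.subtypeVal
  exact Topology.IsEmbedding.of_comp
    (TracelessHermitian.isEmbedding_toMatrix.continuous_iff.2 h1.continuous)
    TracelessHermitian.isEmbedding_toMatrix.continuous h1

instance : ChartedSpace (TracelessHermitian n) (DensityMatrix n) :=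
  isOpenEmbedding_chartMap.singletonChartedSpace

instance : IsManifold 𝓘(ℝ, TracelessHermitian n) ∞ (DensityMatrix n) :=
  isOpenEmbedding_chartMap.isManifold_singleton

end Chart

/-! ### The Bures-Wasserstein metric on the trace-one matrices -/

section Metric

variable {n : ℕ}

/-- The Bures-Wasserstein form at a positive definite `Σ`, restricted to traceless Hermitian
matrices, as a continuous bilinear form. -/
def bwBilin {S : Matrix (Fin n) (Fin n) ℂ} (hS : S.PosDef) :
    TracelessHermitian n →L[ℝ] TracelessHermitian n →L[ℝ] ℝ :=
  LinearMap.toContinuousBilinearMap <|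
    LinearMap.mk₂ ℝ (fun H K : TracelessHermitian n => bwForm S H.toMatrix K.toMatrix)
      (fun H H' K => by
        simp only [bwForm, map_add, lyapunov_add hS, Matrix.add_mul, Matrix.trace_add,
          Complex.add_re]
        ring)
      (fun c H K => by
        simp only [bwForm, map_smul, lyapunov_smul hS, Matrix.smul_mul, Matrix.trace_smul,
          Complex.smul_re, smul_eq_mul]
        ring)
      (fun H K K' => by
        simp only [bwForm, map_add, Matrix.mul_add, Matrix.trace_add, Complex.add_re]
        ring)
      (fun c H K => by
        simp only [bwForm, map_smul, Matrix.mul_smul, Matrix.trace_smul,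
          Complex.smul_re, smul_eq_mul]
        ring)

lemma bwBilin_apply {S : Matrix (Fin n) (Fin n) ℂ} (hS : S.PosDef)
    (H K : TracelessHermitian n) : bwBilin hS H K = bwForm S H.toMatrix K.toMatrix := rfl

lemma bwBilin_pos {S : Matrix (Fin n) (Fin n) ℂ} (hS : S.PosDef)
    {H : TracelessHermitian n} (hH : H ≠ 0) : 0 < bwBilin hS H H :=
  bwForm_pos hS H.isHermitian fun h =>
    hH (TracelessHermitian.toMatrix_injective (h.trans (map_zero _).symm))

lemma bwBilin_isVonNBounded {S : Matrix (Fin n) (Fin n) ℂ} (hS : S.PosDef) :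
    Bornology.IsVonNBounded ℝ {H : TracelessHermitian n | bwBilin hS H H < 1} := by
  rw [NormedSpace.isVonNBounded_iff]
  have hcont : Continuous fun H : TracelessHermitian n => bwBilin hS H H :=
    (bwBilin hS).continuous.clm_apply continuous_id
  rcases subsingleton_or_nontrivial (TracelessHermitian n) with hs | hs
  · exact (Set.subsingleton_of_subsingleton).finite.isBounded
  obtain ⟨H₀, hH₀, hmin⟩ := (isCompact_sphere (0 : TracelessHermitian n) 1).exists_isMinOn
    (NormedSpace.sphere_nonempty.2 zero_le_one) hcont.continuousOn
  have hH₀' : H₀ ≠ 0 := by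
    rintro rfl
    simp at hH₀
  set m := bwBilin hS H₀ H₀ with hm
  have hmpos : 0 < m := bwBilin_pos hS hH₀'
  refine (Metric.isBounded_closedBall (x := (0 : TracelessHermitian n))
    (r := Real.sqrt m⁻¹)).subset fun H hH => ?_
  rw [mem_closedBall_zero_iff]
  rcases eq_or_ne H 0 with rfl | h0
  · simp
  have hn : 0 < ‖H‖ := norm_pos_iff.2 h0
  have h1 : m ≤ bwBilin hS (‖H‖⁻¹ • H) (‖H‖⁻¹ • H) := hmin (by
    simp [norm_smul, inv_mul_cancel₀ hn.ne'])
  simp only [map_smul, smul_apply, smul_eq_mul] at h1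
  have hH' : bwBilin hS H H < 1 := hH
  apply Real.le_sqrt_of_sq_le
  have h2 : m * ‖H‖ ^ 2 ≤ bwBilin hS H H := by
    calc m * ‖H‖ ^ 2 ≤ ‖H‖⁻¹ * (‖H‖⁻¹ * bwBilin hS H H) * ‖H‖ ^ 2 := by gcongr
      _ = bwBilin hS H H := by field_simp
  rw [le_inv_comm₀ (by positivity) hmpos]
  rw [← one_div, le_div_iff₀ (by positivity)]
  linarith

section Smooth

lemma contDiffAt_sylvester {A E : Type*} [NormedRing A] [NormedAlgebra ℝ A]
    [FiniteDimensional ℝ A] [NormedAddCommGroup E] [NormedSpace ℝ E] {f g : E → A} {x : E} {h : A}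
    (hf : ContDiff ℝ ∞ f) (hg : ∀ᶠ y in nhds x, g y * f y + f y * g y = h)
    (hinj : ∀ᶠ y in nhds x, ∀ a, a * f y + f y * a = 0 → a = 0) :
    ContDiffAt ℝ ∞ g x := by
  have : CompleteSpace A := FiniteDimensional.complete ℝ A
  let T : A →L[ℝ] A →L[ℝ] A := (ContinuousLinearMap.mul ℝ A).flip + ContinuousLinearMap.mul ℝ A
  have hT : ∀ s a : A, T s a = a * s + s * a := fun s a => rfl
  have hequiv : ∀ {y : E}, (∀ a, a * f y + f y * a = 0 → a = 0) →
      ∃ e : A ≃L[ℝ] A, (e : A →L[ℝ] A) = T (f y) := fun {y} hy =>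
    ⟨(LinearEquiv.ofInjectiveEndo (T (f y)).toLinearMap
      ((injective_iff_map_eq_zero _).2 hy)).toContinuousLinearEquiv, rfl⟩
  have h1 : ContDiffAt ℝ ∞ (fun y => ContinuousLinearMap.inverse (T (f y)) h) x := by
    have h2 : ContDiffAt ℝ ∞ (fun y => ContinuousLinearMap.inverse (T (f y))) x := by
      have h3 : ContDiffAt ℝ ∞ ContinuousLinearMap.inverse (T (f x)) := by
        obtain ⟨e, he⟩ := hequiv hinj.self_of_nhds
        rw [← he]
        exact contDiffAt_map_inverse _
      exact h3.comp x ((T.contDiff.comp hf).contDiffAt)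
    exact h2.clm_apply contDiffAt_const
  refine h1.congr_of_eventuallyEq ?_
  filter_upwards [hg, hinj] with y hy hy'
  obtain ⟨e, he⟩ := hequiv hy'
  rw [← he, ContinuousLinearMap.inverse_equiv]
  have h4 : e (g y) = h := by
    rw [← hy, ← hT, ← he]
    rfl
  rw [← h4]
  exact (e.symm_apply_apply (g y)).symm

attribute [local instance] Matrix.frobeniusNormedRing Matrix.frobeniusNormedAlgebra

lemma contDiffAt_bwForm {x : TracelessHermitian n} [NeZero n]
    (hx : (x.toMatrix + center n).PosDef) (H K : Matrix (Fin n) (Fin n) ℂ) :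
    ContDiffAt ℝ ∞ (fun y : TracelessHermitian n => bwForm (y.toMatrix + center n) H K) x := by
  have : FiniteDimensional ℝ (Matrix (Fin n) (Fin n) ℂ) :=
    inferInstanceAs (FiniteDimensional ℝ (Fin n → Fin n → ℂ))
  have hf : ContDiff ℝ ∞ fun y : TracelessHermitian n => y.toMatrix + center n :=
    (TracelessHermitian.toMatrix.toContinuousLinearMap.contDiff).add contDiff_const
  have hev := isOpen_posDef.mem_nhds hx
  have h : ContDiffAt ℝ ∞
      (fun y : TracelessHermitian n => lyapunov (y.toMatrix + center n) H) x :=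
    contDiffAt_sylvester (h := H) hf
      (by filter_upwards [hev] with y hy using lyapunov_spec hy H)
      (by filter_upwards [hev] with y hy using fun X hX => lyapunov_injective hy hX)
  let ℓ : Matrix (Fin n) (Fin n) ℂ →ₗ[ℝ] ℝ :=
    { toFun := fun X => (1 / 2 : ℝ) * (Matrix.trace (X * K)).re
      map_add' := fun X Y => by simp [Matrix.add_mul, mul_add]
      map_smul' := fun c X => by simp; ring }
  exact ℓ.toContinuousLinearMap.contDiff.contDiffAt.comp x h

end Smooth

variable [NeZero n]

/-- The Bures-Wasserstein inner product on the tangent space of `D(n)` at `ρ`.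
A tangent vector at `ρ` is the traceless Hermitian matrix which represents it in the affine chart
`ρ ↦ ρ - I / n`, that is, the derivative in the space of matrices of a curve through `ρ`. -/
def bwInner (ρ : DensityMatrix n) :
    TangentSpace 𝓘(ℝ, TracelessHermitian n) ρ →L[ℝ]
      TangentSpace 𝓘(ℝ, TracelessHermitian n) ρ →L[ℝ] ℝ :=
  bwBilin ρ.2.1

lemma trivializationAt_symm (ρ₀ ρ : DensityMatrix n) (v : TracelessHermitian n) :
    (trivializationAt (TracelessHermitian n)
      (TangentSpace 𝓘(ℝ, TracelessHermitian n) (M := DensityMatrix n)) ρ₀).symm ρ v = v := by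
  have hb : ρ ∈ (chartAt (TracelessHermitian n) ρ₀).source := by
    rw [show chartAt (TracelessHermitian n) ρ₀ = chartAt (TracelessHermitian n) ρ from rfl]
    exact mem_chart_source _ ρ
  have h := TangentBundle.symmL_trivializationAt_eq_core
    (I := 𝓘(ℝ, TracelessHermitian n)) hb
  have h2 := (tangentBundleCore 𝓘(ℝ, TracelessHermitian n) (DensityMatrix n)).coordChange_self
    (achart (TracelessHermitian n) ρ) ρ (mem_chart_source _ ρ) v
  have h3 := congrArg (fun L => L v) h
  exact (Bundle.Trivialization.symmL_apply _ (hb := hb) _).symm.trans (h3.trans h2)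

open Classical in
lemma contMDiff_bwBilin : ContMDiff 𝓘(ℝ, TracelessHermitian n)
    𝓘(ℝ, TracelessHermitian n →L[ℝ] TracelessHermitian n →L[ℝ] ℝ) ∞
    (fun ρ : DensityMatrix n => bwBilin ρ.2.1) := by
  let G : TracelessHermitian n → (TracelessHermitian n →L[ℝ] TracelessHermitian n →L[ℝ] ℝ) :=
    fun y => if h : (y.toMatrix + center n).PosDef then bwBilin h else 0
  let U : Set (TracelessHermitian n) := {y | (y.toMatrix + center n).PosDef}
  have hG : ContDiffOn ℝ ∞ G U := by
    rw [contDiffOn_clm_apply]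
    intro H
    rw [contDiffOn_clm_apply]
    intro K
    have h1 : ContDiffOn ℝ ∞ (fun y : TracelessHermitian n =>
        bwForm (y.toMatrix + center n) H.toMatrix K.toMatrix) U := fun y hy =>
      (contDiffAt_bwForm hy _ _).contDiffWithinAt
    refine h1.congr fun y hy => ?_
    have hy' : (y.toMatrix + center n).PosDef := hy
    simp only [G, dif_pos hy', bwBilin_apply]
  have hmem : ∀ ρ : DensityMatrix n, chartMap ρ ∈ U := fun ρ => by
    simpa [U, toMatrix_chartMap] using ρ.2.1
  intro ρ
  have hchart : ContMDiffAt 𝓘(ℝ, TracelessHermitian n) 𝓘(ℝ, TracelessHermitian n) ∞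
      (chartMap (n := n)) ρ :=
    contMDiffAt_extChartAt (I := 𝓘(ℝ, TracelessHermitian n)) (x := ρ)
  have hGat : ContDiffAt ℝ ∞ G (chartMap ρ) :=
    hG.contDiffAt (isOpen_posDef.mem_nhds (hmem ρ))
  refine (hGat.contMDiffAt.comp ρ hchart).congr_of_eventuallyEq
    (Filter.Eventually.of_forall fun σ => ?_)
  have hσ : ((chartMap σ).toMatrix + center n) = σ.1 := by simp [toMatrix_chartMap]
  have hσ' : ((chartMap σ).toMatrix + center n).PosDef := hmem σ
  ext H K
  simp only [Function.comp_apply, G]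
  rw [dif_pos hσ', bwBilin_apply, bwBilin_apply, hσ]

lemma contMDiff_bwInner : ContMDiff 𝓘(ℝ, TracelessHermitian n)
    (𝓘(ℝ, TracelessHermitian n).prod
      𝓘(ℝ, TracelessHermitian n →L[ℝ] TracelessHermitian n →L[ℝ] ℝ)) ∞
    (fun ρ : DensityMatrix n => Bundle.TotalSpace.mk'
      (TracelessHermitian n →L[ℝ] TracelessHermitian n →L[ℝ] ℝ)
      (E := fun ρ : DensityMatrix n => TangentSpace 𝓘(ℝ, TracelessHermitian n) ρ →L[ℝ]
        TangentSpace 𝓘(ℝ, TracelessHermitian n) ρ →L[ℝ] ℝ) ρ (bwInner ρ)) := by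
  intro ρ₀
  rw [Bundle.contMDiffAt_section]
  refine (contMDiff_bwBilin ρ₀).congr_of_eventuallyEq (Filter.Eventually.of_forall fun ρ => ?_)
  have hb : ρ ∈ (trivializationAt (TracelessHermitian n)
      (TangentSpace 𝓘(ℝ, TracelessHermitian n) (M := DensityMatrix n)) ρ₀).baseSet := by
    rw [TangentBundle.trivializationAt_baseSet,
      show chartAt (TracelessHermitian n) ρ₀ = chartAt (TracelessHermitian n) ρ from rfl]
    exact mem_chart_source _ ρ
  ext v w
  refine (inCoordinates_apply_eq₂ (𝕜 := ℝ) (F₃ := ℝ)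
    (E₃ := Bundle.Trivial (DensityMatrix n) ℝ) hb hb (Set.mem_univ _)).trans ?_
  have htriv : ∀ a : ℝ, (trivializationAt ℝ (Bundle.Trivial (DensityMatrix n) ℝ) ρ₀).linearMapAt
      ℝ ρ a = a := fun a => by simp
  rw [trivializationAt_symm, trivializationAt_symm]
  exact htriv _

/-- The restriction of the Bures-Wasserstein metric to `D(n)`, as a smooth Riemannian metric. -/
def bwMetric (n : ℕ) [NeZero n] :
    Bundle.ContMDiffRiemannianMetric 𝓘(ℝ, TracelessHermitian n) ∞ (TracelessHermitian n)
      (fun ρ : DensityMatrix n => TangentSpace 𝓘(ℝ, TracelessHermitian n) ρ) where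
  inner := bwInner
  symm ρ _ _ := bwForm_symm ρ.2.1 _ _
  pos ρ _ hH := bwBilin_pos ρ.2.1 hH
  isVonNBounded ρ := bwBilin_isVonNBounded ρ.2.1
  contMDiff := contMDiff_bwInner

end Metric

instance (n : ℕ) [NeZero n] : Bundle.RiemannianBundle
    (fun ρ : DensityMatrix n => TangentSpace 𝓘(ℝ, TracelessHermitian n) ρ) :=
  ⟨(bwMetric n).toRiemannianMetric⟩

end BuresWasserstein

end

open BuresWasserstein Manifold

namespace BuresWasserstein

/-! ### Fidelity and the Bures-Wasserstein form -/

section Fidelity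

open Matrix

variable {n : ℕ} {R S : Matrix (Fin n) (Fin n) ℂ}

/-! The formula is spherical geometry. For positive definite `R` with trace one, `⟨X, Y⟩ = Re tr (X
R Y)` is an inner product on Hermitian matrices in which `1` is a unit vector. Writing a tangent
vector as `H = L R + R L`, the squared metric length of `H` is `⟨L, L⟩` (`bwForm_self`). The matrix
`T = optMap R S` satisfies `T R T = S`, so it is a unit vector too, and its inner product with `1`
is the fidelity `F`. Hence `arccos F` is the angle between `1` and `T`.

Lower bound: along a curve towards `S`, the derivative of the fidelity is the inner product of `T -
F • 1` with `L`. Since `T - F • 1` has squared norm `1 - F ^ 2`, Cauchy-Schwarz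
(`sq_half_re_trace_optMap_mul_le`) shows that `arccos F` changes no faster than arc length.

Upper bound: let `W` run along the great circle arc from `1` to `T`. Then `W R W` runs from `R` to
`S`; it keeps trace one because `W` is a unit vector, and `bwForm_mul_mul` gives it unit speed. Its
length is therefore `arccos F`. -/

lemma mul_mul_posDef {W : Matrix (Fin n) (Fin n) ℂ} (hR : R.PosDef) (hW : W.PosDef) :
    (W * R * W).PosDef := by
  simpa [hW.isHermitian.eq] using
    hR.conjTranspose_mul_mul_same (Matrix.mulVec_injective_of_isUnit hW.isUnit)

lemma sqrt_posDef (hS : S.PosDef) : (CFC.sqrt S).PosDef := by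
  refine (CFC.sqrt_nonneg S).posSemidef.posDef_iff_isUnit.2 ?_
  have h : CFC.sqrt S * CFC.sqrt S = S := CFC.sqrt_mul_sqrt_self S hS.posSemidef.nonneg
  exact isUnit_of_mul_isUnit_left (h ▸ hS.isUnit)

lemma sqrt_mul_mul_sqrt_posDef (hR : R.PosDef) (hS : S.PosDef) :
    (CFC.sqrt S * R * CFC.sqrt S).PosDef :=
  mul_mul_posDef hR (sqrt_posDef hS)

/-- The fidelity of two positive definite matrices. -/
noncomputable def fidelity (R S : Matrix (Fin n) (Fin n) ℂ) : ℝ :=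
  (trace (CFC.sqrt (CFC.sqrt S * R * CFC.sqrt S))).re

/-- The positive definite matrix `T` with `T R T = S`. -/
noncomputable def optMap (R S : Matrix (Fin n) (Fin n) ℂ) : Matrix (Fin n) (Fin n) ℂ :=
  CFC.sqrt S * (CFC.sqrt (CFC.sqrt S * R * CFC.sqrt S))⁻¹ * CFC.sqrt S

lemma optMap_posDef (hR : R.PosDef) (hS : S.PosDef) : (optMap R S).PosDef :=
  mul_mul_posDef (sqrt_posDef (sqrt_mul_mul_sqrt_posDef hR hS)).inv (sqrt_posDef hS)

lemma optMap_mul_mul_optMap (hR : R.PosDef) (hS : S.PosDef) :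
    optMap R S * R * optMap R S = S := by
  have hB : CFC.sqrt S * CFC.sqrt S = S := CFC.sqrt_mul_sqrt_self S hS.posSemidef.nonneg
  have hA := sqrt_mul_mul_sqrt_posDef hR hS
  have hM := CFC.sqrt_mul_sqrt_self _ hA.posSemidef.nonneg
  have hdet := (Matrix.isUnit_iff_isUnit_det _).1 (sqrt_posDef hA).isUnit
  unfold optMap
  set B := CFC.sqrt S
  set M := CFC.sqrt (B * R * B)
  calc B * M⁻¹ * B * R * (B * M⁻¹ * B) = B * (M⁻¹ * (B * R * B) * M⁻¹) * B := by
        simp only [Matrix.mul_assoc]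
    -- The middle factor `B * R * B` is `M * M`, so both inverses cancel.
    _ = B * ((M⁻¹ * M) * (M * M⁻¹)) * B := by rw [← hM]; simp only [Matrix.mul_assoc]
    _ = S := by rw [nonsing_inv_mul _ hdet, mul_nonsing_inv _ hdet]; simpa using hB

lemma trace_optMap_mul (hR : R.PosDef) (hS : S.PosDef) :
    trace (optMap R S * R) = trace (CFC.sqrt (CFC.sqrt S * R * CFC.sqrt S)) := by
  have hA := sqrt_mul_mul_sqrt_posDef hR hS
  have hM := CFC.sqrt_mul_sqrt_self _ hA.posSemidef.nonneg
  have hdet := (Matrix.isUnit_iff_isUnit_det _).1 (sqrt_posDef hA).isUnit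
  unfold optMap
  set B := CFC.sqrt S
  set M := CFC.sqrt (B * R * B)
  calc trace (B * M⁻¹ * B * R) = trace (M⁻¹ * (B * R * B)) := by
        rw [Matrix.mul_assoc, Matrix.mul_assoc, Matrix.trace_mul_comm]
        simp only [Matrix.mul_assoc]
    _ = trace M := by rw [← hM, ← Matrix.mul_assoc, nonsing_inv_mul _ hdet, Matrix.one_mul]

lemma re_trace_optMap_mul (hR : R.PosDef) (hS : S.PosDef) :
    (trace (optMap R S * R)).re = fidelity R S := by
  rw [trace_optMap_mul hR hS, fidelity]

lemma fidelity_nonneg (R S : Matrix (Fin n) (Fin n) ℂ) : 0 ≤ fidelity R S :=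
  (Complex.le_def.1 (CFC.sqrt_nonneg (CFC.sqrt S * R * CFC.sqrt S)).posSemidef.trace_nonneg).1

lemma re_trace_conjTranspose (X : Matrix (Fin n) (Fin n) ℂ) : (trace Xᴴ).re = (trace X).re := by
  rw [trace_conjTranspose, Complex.star_def, Complex.conj_re]

/-! ### The inner product `Re tr (X R Y)` on Hermitian matrices. -/

lemma re_trace_mul_mul_comm {X Y : Matrix (Fin n) (Fin n) ℂ} (hR : R.IsHermitian)
    (hX : X.IsHermitian) (hY : Y.IsHermitian) :
    (trace (X * R * Y)).re = (trace (Y * R * X)).re := by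
  rw [← re_trace_conjTranspose (X * R * Y)]
  simp only [conjTranspose_mul, hR.eq, hX.eq, hY.eq, Matrix.mul_assoc]

lemma re_trace_mul_mul_self_nonneg (hR : R.PosDef) {X : Matrix (Fin n) (Fin n) ℂ}
    (hX : X.IsHermitian) : 0 ≤ (trace (X * R * X)).re := by
  simpa only [hX.eq] using trace_conj_re_nonneg hR X

/-- Cauchy-Schwarz: the squared norm of `X + t • Y` is a nonnegative quadratic in `t`, so its
discriminant is nonpositive. -/
lemma sq_re_trace_mul_mul_le (hR : R.PosDef) {X Y : Matrix (Fin n) (Fin n) ℂ}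
    (hX : X.IsHermitian) (hY : Y.IsHermitian) :
    (trace (X * R * Y)).re ^ 2 ≤ (trace (X * R * X)).re * (trace (Y * R * Y)).re := by
  have h : ∀ t : ℝ, 0 ≤ (trace (Y * R * Y)).re * (t * t) +
      (2 * (trace (X * R * Y)).re) * t + (trace (X * R * X)).re := by
    intro t
    have hH : (X + t • Y).IsHermitian := by
      simp [IsHermitian, conjTranspose_smul, hX.eq, hY.eq]
    have h1 := re_trace_mul_mul_self_nonneg hR hH
    have h2 := re_trace_mul_mul_comm hR.isHermitian hX hY
    have h3 : (trace ((X + t • Y) * R * (X + t • Y))).re = (trace (X * R * X)).re +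
        t * (trace (X * R * Y)).re + t * (trace (Y * R * X)).re +
        t * t * (trace (Y * R * Y)).re := by
      simp only [add_mul, mul_add, smul_mul_assoc, mul_smul_comm, trace_add, trace_smul,
        Complex.add_re, Complex.smul_re, smul_eq_mul]
      ring
    rw [h3, ← h2] at h1
    linarith
  have := discrim_le_zero h
  unfold discrim at this
  nlinarith

lemma bwForm_self (hR : R.PosDef) {H : Matrix (Fin n) (Fin n) ℂ} :
    bwForm R H H = (trace (lyapunov R H * R * lyapunov R H)).re := by
  set L := lyapunov R H with hL
  have h1 : trace (L * H) = trace (L * R * L) + trace (L * R * L) := by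
    calc trace (L * H) = trace (L * (L * R + R * L)) := by rw [lyapunov_spec hR H]
      _ = _ := by rw [mul_add, trace_add, trace_mul_comm L (L * R), ← Matrix.mul_assoc]
  rw [bwForm, ← hL, h1, Complex.add_re]
  ring

lemma bwForm_nonneg {S H : Matrix (Fin n) (Fin n) ℂ} (hS : S.PosDef) (hH : H.IsHermitian) :
    0 ≤ bwForm S H H := by
  rw [bwForm_self hS]
  exact re_trace_mul_mul_self_nonneg hS (lyapunov_isHermitian hS hH)

/-- Substituting `H = L R + R L` yields two terms with equal real parts. This turns the derivative
of the fidelity into an inner product to which Cauchy-Schwarz applies. -/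
lemma half_re_trace_mul (hR : R.PosDef) {X H : Matrix (Fin n) (Fin n) ℂ} (hX : X.IsHermitian)
    (hH : H.IsHermitian) :
    1 / 2 * (trace (X * H)).re = (trace (X * R * lyapunov R H)).re := by
  have hL := lyapunov_isHermitian hR hH
  have h := re_trace_mul_mul_comm hR.isHermitian hX hL
  have h2 : trace (X * (lyapunov R H * R)) = trace (lyapunov R H * R * X) := trace_mul_comm _ _
  rw [← lyapunov_spec hR H, mul_add, trace_add, Complex.add_re, lyapunov_spec hR H, h2, ← h,
    ← Matrix.mul_assoc]
  ring

lemma isHermitian_sub_smul_one {T : Matrix (Fin n) (Fin n) ℂ} (hT : T.IsHermitian) (c : ℝ) :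
    (T - c • (1 : Matrix (Fin n) (Fin n) ℂ)).IsHermitian := by
  simp [IsHermitian, conjTranspose_smul, hT.eq]

/-- Pythagoras: `1` and `optMap R S` are unit vectors with inner product the fidelity, and the
difference is the component of `optMap R S` orthogonal to `1`. -/
lemma re_trace_optMap_sub (hR : R.PosDef) (hS : S.PosDef) (hR1 : R.trace = 1) (hS1 : S.trace = 1) :
    (trace ((optMap R S - fidelity R S • 1) * R * (optMap R S - fidelity R S • 1))).re =
      1 - fidelity R S ^ 2 := by
  have h1 := re_trace_optMap_mul hR hS
  have h2 : (trace (R * optMap R S)).re = fidelity R S := by rw [trace_mul_comm, h1]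
  simp only [sub_mul, mul_sub, smul_mul_assoc, mul_smul_comm, trace_sub, trace_smul, mul_one,
    one_mul, Complex.sub_re, Complex.smul_re, smul_eq_mul, optMap_mul_mul_optMap hR hS, h1, h2,
    hR1, hS1, Complex.one_re]
  ring

lemma fidelity_sq_le_one (hR : R.PosDef) (hS : S.PosDef) (hR1 : R.trace = 1) (hS1 : S.trace = 1) :
    fidelity R S ^ 2 ≤ 1 := by
  have h := re_trace_mul_mul_self_nonneg hR
    (isHermitian_sub_smul_one (optMap_posDef hR hS).isHermitian (fidelity R S))
  rw [re_trace_optMap_sub hR hS hR1 hS1] at h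
  linarith

lemma fidelity_le_one (hR : R.PosDef) (hS : S.PosDef) (hR1 : R.trace = 1) (hS1 : S.trace = 1) :
    fidelity R S ≤ 1 :=
  (abs_le_one_iff_mul_self_le_one.2
    (by simpa [sq] using fidelity_sq_le_one hR hS hR1 hS1) |> abs_le.1).2

lemma eq_of_fidelity_eq_one (hR : R.PosDef) (hS : S.PosDef) (hR1 : R.trace = 1)
    (hS1 : S.trace = 1) (h : fidelity R S = 1) : R = S := by
  have h1 := re_trace_optMap_sub hR hS hR1 hS1
  have hH := isHermitian_sub_smul_one (optMap_posDef hR hS).isHermitian (fidelity R S)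
  have h2 : optMap R S - fidelity R S • 1 = 0 := by
    refine eq_zero_of_trace_conj hR ?_
    rw [hH.eq, h1, h]
    norm_num
  have h3 : optMap R S = 1 := by simpa [h, sub_eq_zero] using h2
  simpa [h3] using optMap_mul_mul_optMap hR hS

lemma fidelity_self (hR : R.PosDef) (hR1 : R.trace = 1) : fidelity R R = 1 := by
  have hB : CFC.sqrt R * CFC.sqrt R = R := CFC.sqrt_mul_sqrt_self R hR.posSemidef.nonneg
  have h : CFC.sqrt R * R * CFC.sqrt R = R * R := by
    calc CFC.sqrt R * R * CFC.sqrt R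
        = CFC.sqrt R * (CFC.sqrt R * CFC.sqrt R) * CFC.sqrt R := by rw [hB]
      _ = (CFC.sqrt R * CFC.sqrt R) * (CFC.sqrt R * CFC.sqrt R) := by
        simp only [Matrix.mul_assoc]
      _ = R * R := by rw [hB]
  rw [fidelity, h, CFC.sqrt_mul_self R hR.posSemidef.nonneg, hR1, Complex.one_re]

lemma sq_half_re_trace_optMap_mul_le (hR : R.PosDef) (hS : S.PosDef) (hR1 : R.trace = 1)
    (hS1 : S.trace = 1) {H : Matrix (Fin n) (Fin n) ℂ} (hH : H.IsHermitian) (hH0 : H.trace = 0) :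
    (1 / 2 * (trace (optMap R S * H)).re) ^ 2 ≤ (1 - fidelity R S ^ 2) * bwForm R H H := by
  have hX := isHermitian_sub_smul_one (optMap_posDef hR hS).isHermitian (fidelity R S)
  -- As `H` is traceless, multiples of `1` may be subtracted freely; this choice gives the vector of
  -- least norm and hence the sharp constant.
  have h1 : trace (optMap R S * H) = trace ((optMap R S - fidelity R S • 1) * H) := by
    simp [sub_mul, hH0]
  rw [h1, half_re_trace_mul hR hX hH, bwForm_self hR, ← re_trace_optMap_sub hR hS hR1 hS1]
  exact sq_re_trace_mul_mul_le hR hX (lyapunov_isHermitian hR hH)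

/-- If `M` is the square root of `√S R √S` and `M'` its derivative in the direction `H`, then
the derivative of the trace is given by the matrix `optMap R S`. -/
lemma trace_deriv_sqrt (hR : R.PosDef) (hS : S.PosDef) {M' H : Matrix (Fin n) (Fin n) ℂ}
    (h : M' * CFC.sqrt (CFC.sqrt S * R * CFC.sqrt S) +
      CFC.sqrt (CFC.sqrt S * R * CFC.sqrt S) * M' = CFC.sqrt S * H * CFC.sqrt S) :
    (trace M').re = 1 / 2 * (trace (optMap R S * H)).re := by
  have hA := sqrt_mul_mul_sqrt_posDef hR hS
  have hdet := (Matrix.isUnit_iff_isUnit_det _).1 (sqrt_posDef hA).isUnit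
  unfold optMap
  set B := CFC.sqrt S
  set M := CFC.sqrt (B * R * B)
  have h1 : trace (B * M⁻¹ * B * H) = trace (M⁻¹ * (B * H * B)) := by
    rw [Matrix.mul_assoc, Matrix.mul_assoc, Matrix.trace_mul_comm]
    simp only [Matrix.mul_assoc]
  -- Cyclicity gives `tr (M⁻¹ (M' M + M M')) = 2 tr M'`, the source of the factor one half.
  rw [h1, ← h, mul_add, trace_add, ← Matrix.mul_assoc M⁻¹ M, nonsing_inv_mul _ hdet,
    Matrix.one_mul, trace_mul_comm, Matrix.mul_assoc, mul_nonsing_inv _ hdet, Matrix.mul_one,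
    Complex.add_re]
  ring

/-- The squared speed of a curve `W R W` which is moved by commuting matrices `W`. -/
lemma bwForm_mul_mul {W D : Matrix (Fin n) (Fin n) ℂ} (hW : W.PosDef)
    (hWR : (W * R * W).PosDef) (hc : Commute W D) :
    bwForm (W * R * W) (D * R * W + W * R * D) (D * R * W + W * R * D) =
      (trace (D * R * D)).re := by
  have hdet := (Matrix.isUnit_iff_isUnit_det _).1 hW.isUnit
  have h1 : W * D * W⁻¹ = D := by
    rw [hc.eq, Matrix.mul_assoc, mul_nonsing_inv _ hdet, Matrix.mul_one]
  have h2 : D * W⁻¹ * (W * R * W) = D * R * W := by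
    rw [Matrix.mul_assoc W, Matrix.mul_assoc D, ← Matrix.mul_assoc W⁻¹, nonsing_inv_mul _ hdet]
    simp only [Matrix.one_mul, Matrix.mul_assoc]
  -- Commutation of `D` with `W` is what makes `D * W⁻¹` solve the Lyapunov equation: it lets `W * D
  -- * W⁻¹` collapse to `D`.
  have hL : lyapunov (W * R * W) (D * R * W + W * R * D) = D * W⁻¹ := by
    refine lyapunov_eq hWR ?_
    rw [h2]
    congr 1
    calc W * R * W * (D * W⁻¹) = W * R * (W * D * W⁻¹) := by simp only [Matrix.mul_assoc]
      _ = _ := by rw [h1]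
  rw [bwForm_self hWR, hL, h2]
  congr 2
  calc D * R * W * (D * W⁻¹) = D * R * (W * D * W⁻¹) := by simp only [Matrix.mul_assoc]
    _ = _ := by rw [h1]

end Fidelity

/-! ### Differentiability of the square root and of the fidelity along curves -/

section Sqrt

open Matrix
open scoped Matrix.Norms.L2Operator Topology

variable {n : ℕ} {R S : Matrix (Fin n) (Fin n) ℂ}

lemma continuous_sqrt_comp {A : ℝ → Matrix (Fin n) (Fin n) ℂ} (hA : Continuous A)
    (hpos : ∀ t, (A t).PosDef) : Continuous fun t => CFC.sqrt (A t) := by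
  simp_rw [CFC.sqrt_eq_cfc]
  exact hA.cfc_nnreal_of_mem_nhdsSet (s := Set.univ) _ Filter.univ_mem
    (fun t => (hpos t).posSemidef.nonneg) NNReal.continuous_sqrt.continuousOn

/-- Inverse function theorem for `X ↦ X * X`: its derivative at `M` is `X ↦ X M + M X`, injective by
uniqueness in the Lyapunov equation. -/
lemma contDiff_sqrt_comp {A : ℝ → Matrix (Fin n) (Fin n) ℂ} (hA : ContDiff ℝ 1 A)
    (hpos : ∀ t, (A t).PosDef) : ContDiff ℝ 1 fun t => CFC.sqrt (A t) := by
  rw [contDiff_iff_contDiffAt]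
  intro t
  have hsq : ∀ s, CFC.sqrt (A s) * CFC.sqrt (A s) = A s := fun s =>
    CFC.sqrt_mul_sqrt_self _ (hpos s).posSemidef.nonneg
  have hM := sqrt_posDef (hpos t)
  set M := CFC.sqrt (A t) with hMdef
  let f : Matrix (Fin n) (Fin n) ℂ → Matrix (Fin n) (Fin n) ℂ := fun X => X * X
  have hf : ContDiffAt ℝ 1 f M := (contDiff_id.mul contDiff_id).contDiffAt
  let L := (ContinuousLinearMap.mul ℝ (Matrix (Fin n) (Fin n) ℂ)).flip M +
    ContinuousLinearMap.mul ℝ (Matrix (Fin n) (Fin n) ℂ) M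
  have hinj : Function.Injective L.toLinearMap :=
    (injective_iff_map_eq_zero _).2 fun X hX => lyapunov_injective hM hX
  let e : Matrix (Fin n) (Fin n) ℂ ≃L[ℝ] Matrix (Fin n) (Fin n) ℂ :=
    (LinearEquiv.ofInjectiveEndo L.toLinearMap hinj).toContinuousLinearEquiv
  have hf' : HasFDerivAt f (e : Matrix (Fin n) (Fin n) ℂ →L[ℝ] Matrix (Fin n) (Fin n) ℂ) M := by
    refine ((hasFDerivAt_id M).mul' (hasFDerivAt_id M)).congr_fderiv ?_
    ext1 X
    exact add_comm _ _
  have hg := hf.to_localInverse hf' one_ne_zero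
  have hinv := (hf.hasStrictFDerivAt' hf' one_ne_zero).eventually_left_inverse
  have hfM : f M = A t := hsq t
  rw [hfM] at hg
  refine (hg.comp t hA.contDiffAt).congr_of_eventuallyEq ?_
  -- Continuity keeps the positive root near `M`, where it must coincide with the local inverse.
  have hcont := (continuous_sqrt_comp hA.continuous hpos).continuousAt (x := t)
  filter_upwards [hcont.eventually hinv] with s hs
  change CFC.sqrt (A s) = hf.localInverse hf' one_ne_zero (A s)
  have hfs : f (CFC.sqrt (A s)) = A s := hsq s
  rw [hfs] at hs
  exact hs.symm

lemma contDiff_fidelity_comp {A : ℝ → Matrix (Fin n) (Fin n) ℂ} (hA : ContDiff ℝ 1 A)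
    (hpos : ∀ t, (A t).PosDef) (hS : S.PosDef) : ContDiff ℝ 1 fun t => fidelity (A t) S :=
  ((Complex.reCLM ∘L (Matrix.traceLinearMap (Fin n) ℝ ℂ).toContinuousLinearMap).contDiff).comp
    (contDiff_sqrt_comp ((contDiff_const.mul hA).mul contDiff_const)
      fun t => sqrt_mul_mul_sqrt_posDef (hpos t) hS)

lemma deriv_fidelity_comp {A : ℝ → Matrix (Fin n) (Fin n) ℂ} (hA : ContDiff ℝ 1 A)
    (hpos : ∀ t, (A t).PosDef) (hS : S.PosDef) (t : ℝ) :
    deriv (fun s => fidelity (A s) S) t = 1 / 2 * (trace (optMap (A t) S * deriv A t)).re := by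
  let Q : ℝ → Matrix (Fin n) (Fin n) ℂ := fun s => CFC.sqrt S * A s * CFC.sqrt S
  have hQ : ContDiff ℝ 1 Q := (contDiff_const.mul hA).mul contDiff_const
  have hQpos : ∀ s, (Q s).PosDef := fun s => sqrt_mul_mul_sqrt_posDef (hpos s) hS
  let M : ℝ → Matrix (Fin n) (Fin n) ℂ := fun s => CFC.sqrt (Q s)
  have hM : HasDerivAt M (deriv M t) t :=
    ((contDiff_sqrt_comp hQ hQpos).differentiable one_ne_zero t).hasDerivAt
  have hA' : HasDerivAt A (deriv A t) t := (hA.differentiable one_ne_zero t).hasDerivAt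
  have hMM : M * M = Q := funext fun s => CFC.sqrt_mul_sqrt_self _ (hQpos s).posSemidef.nonneg
  -- Differentiating `M * M = Q` gives the Lyapunov equation for the derivative of the root.
  have h1 : HasDerivAt Q (deriv M t * M t + M t * deriv M t) t := hMM ▸ hM.mul hM
  have h2 : HasDerivAt Q (CFC.sqrt S * deriv A t * CFC.sqrt S) t :=
    (hA'.const_mul _).mul_const _
  have h3 := trace_deriv_sqrt (hpos t) hS (h1.unique h2)
  rw [← h3]
  exact ((Complex.reCLM ∘L
    (Matrix.traceLinearMap (Fin n) ℝ ℂ).toContinuousLinearMap).hasFDerivAt.comp_hasDerivAt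
      t hM).deriv

end Sqrt

/-! ### The lower bound for the distance -/

section LowerBound

open Matrix MeasureTheory Set
open scoped Topology

variable {n : ℕ} [NeZero n]

/-! ### Curves and their speed in the global chart. -/

lemma contDiff_chartMap_comp {γ : ℝ → DensityMatrix n}
    (hγ : ContMDiff 𝓘(ℝ, ℝ) 𝓘(ℝ, TracelessHermitian n) 1 γ) : ContDiff ℝ 1 (chartMap ∘ γ) := by
  rw [← contMDiff_iff_contDiff]
  exact (contMDiff_isOpenEmbedding isOpenEmbedding_chartMap).comp hγ

lemma contMDiffOn_of_contDiffOn_chartMap_comp {γ : ℝ → DensityMatrix n} {s : Set ℝ}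
    (hγ : ContDiffOn ℝ 1 (chartMap ∘ γ) s) :
    ContMDiffOn 𝓘(ℝ, ℝ) 𝓘(ℝ, TracelessHermitian n) 1 γ s := by
  have h : γ = (isOpenEmbedding_chartMap.toOpenPartialHomeomorph chartMap).symm ∘
      chartMap ∘ γ := by
    ext1 t
    exact (isOpenEmbedding_chartMap.toOpenPartialHomeomorph_left_inv).symm
  rw [h]
  exact (contMDiffOn_isOpenEmbedding_symm isOpenEmbedding_chartMap).comp
    (contMDiffOn_iff_contDiffOn.2 hγ) fun t _ => mem_range_self (γ t)

lemma mfderiv_apply_one {γ : ℝ → DensityMatrix n} {t : ℝ}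
    (hγ : MDifferentiableAt 𝓘(ℝ, ℝ) 𝓘(ℝ, TracelessHermitian n) γ t) :
    (mfderiv 𝓘(ℝ, ℝ) 𝓘(ℝ, TracelessHermitian n) γ t 1 : TracelessHermitian n) =
      deriv (chartMap ∘ γ) t := by
  rw [hγ.mfderiv]
  have h : writtenInExtChartAt 𝓘(ℝ, ℝ) 𝓘(ℝ, TracelessHermitian n) t γ = chartMap ∘ γ := rfl
  rw [h]
  simp only [modelWithCornersSelf_coe, range_id, fderivWithin_univ]
  rfl

lemma enorm_tangent (ρ : DensityMatrix n) (v : TangentSpace 𝓘(ℝ, TracelessHermitian n) ρ) :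
    ‖v‖ₑ = ENNReal.ofReal (√(bwForm ρ.1 (TracelessHermitian.toMatrix v)
      (TracelessHermitian.toMatrix v))) := by
  have h : ‖v‖ = √(bwForm ρ.1 (TracelessHermitian.toMatrix v)
      (TracelessHermitian.toMatrix v)) := by
    rw [@norm_eq_sqrt_real_inner]
    rfl
  rw [← h, ofReal_norm]

open scoped Matrix.Norms.L2Operator

lemma contDiff_val_comp {γ : ℝ → DensityMatrix n} (hγ : ContDiff ℝ 1 (chartMap ∘ γ)) :
    ContDiff ℝ 1 fun t => (γ t).1 := by
  have h : (fun t => (γ t).1) =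
      fun t => TracelessHermitian.toMatrix.toContinuousLinearMap ((chartMap ∘ γ) t) + center n := by
    ext1 t
    simp [toMatrix_chartMap]
  rw [h]
  exact (ContinuousLinearMap.contDiff _ |>.comp hγ).add contDiff_const

lemma deriv_val_comp {γ : ℝ → DensityMatrix n} {t : ℝ}
    (hγ : DifferentiableAt ℝ (chartMap ∘ γ) t) :
    HasDerivAt (fun t => (γ t).1) (TracelessHermitian.toMatrix (deriv (chartMap ∘ γ) t)) t := by
  have h : (fun t => (γ t).1) =
      fun t => TracelessHermitian.toMatrix.toContinuousLinearMap ((chartMap ∘ γ) t) + center n := by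
    ext1 t
    simp [toMatrix_chartMap]
  rw [h]
  exact ((ContinuousLinearMap.hasFDerivAt _).comp_hasDerivAt t hγ.hasDerivAt).add_const _

/-- The fidelity reaches `1`, where `arccos` is not differentiable; the factor `c` keeps the
argument inside `(-1, 1)`. The estimate survives because `c ^ 2 * (1 - f ^ 2) ≤ 1 - (c * f) ^ 2`. -/
lemma abs_deriv_arccos_le {f : ℝ → ℝ} {c b t : ℝ} (hf : DifferentiableAt ℝ f t)
    (hc : c ^ 2 < 1) (hft : f t ^ 2 ≤ 1) (hb : 0 ≤ b)
    (h : deriv f t ^ 2 ≤ (1 - f t ^ 2) * b) :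
    |deriv (fun s => Real.arccos (c * f s)) t| ≤ √b := by
  have h1 : (c * f t) ^ 2 < 1 := by
    rw [mul_pow]; nlinarith [sq_nonneg (f t), sq_nonneg c]
  have h2 := (abs_lt.1 ((sq_lt_one_iff_abs_lt_one _).1 h1))
  have h3 : HasDerivAt (fun s => Real.arccos (c * f s))
      (-(1 / √(1 - (c * f t) ^ 2)) * (c * deriv f t)) t :=
    HasDerivAt.comp (h₂ := Real.arccos) (h := fun s => c * f s) t
      (Real.hasDerivAt_arccos h2.1.ne' h2.2.ne) (hf.hasDerivAt.const_mul c)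
  have h4 : 0 < 1 - (c * f t) ^ 2 := by linarith
  rw [h3.deriv, ← Real.sqrt_sq_eq_abs]
  apply Real.sqrt_le_sqrt
  have h5 : (-(1 / √(1 - (c * f t) ^ 2)) * (c * deriv f t)) ^ 2 =
      (c ^ 2 * deriv f t ^ 2) / (1 - (c * f t) ^ 2) := by
    rw [mul_pow, neg_sq, div_pow, Real.sq_sqrt h4.le]
    ring
  rw [h5, div_le_iff₀ h4]
  calc c ^ 2 * deriv f t ^ 2 ≤ c ^ 2 * ((1 - f t ^ 2) * b) := by gcongr
    _ = c ^ 2 * (1 - f t ^ 2) * b := by ring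
    _ ≤ (1 - (c * f t) ^ 2) * b := by
      gcongr
      rw [mul_pow]
      linarith
    _ = _ := mul_comm _ _

lemma ofReal_arccos_sub_le_pathELength {γ : ℝ → DensityMatrix n}
    (hγ : ContMDiff 𝓘(ℝ, ℝ) 𝓘(ℝ, TracelessHermitian n) 1 γ) {c : ℝ} (hc : c ^ 2 < 1) :
    ENNReal.ofReal (Real.arccos (c * fidelity (γ 0).1 (γ 1).1) - Real.arccos c) ≤
      pathELength 𝓘(ℝ, TracelessHermitian n) γ 0 1 := by
  set S := (γ 1).1 with hSdef
  have hS : S.PosDef := (γ 1).2.1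
  have hx := contDiff_chartMap_comp hγ
  have hA := contDiff_val_comp hx
  have hf := contDiff_fidelity_comp hA (fun t => (γ t).2.1) hS
  set f : ℝ → ℝ := fun t => fidelity (γ t).1 S with hfdef
  have hf1 : ∀ t, f t ^ 2 ≤ 1 := fun t =>
    fidelity_sq_le_one (γ t).2.1 hS (γ t).2.2 (γ 1).2.2
  have hφ : ContDiff ℝ 1 fun t => Real.arccos (c * f t) := by
    rw [contDiff_iff_contDiffAt]
    intro t
    have h1 : (c * f t) ^ 2 < 1 := by
      rw [mul_pow]; nlinarith [sq_nonneg (f t), sq_nonneg c, hf1 t]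
    have h2 := (abs_lt.1 ((sq_lt_one_iff_abs_lt_one _).1 h1))
    exact ContDiffAt.comp (g := Real.arccos) (f := fun t => c * f t) t
      (Real.contDiffAt_arccos h2.1.ne' h2.2.ne) (contDiff_const.mul hf).contDiffAt
  have h1 := enorm_sub_le_lintegral_deriv_of_contDiffOn_Icc hφ.contDiffOn
    (zero_le_one (α := ℝ))
  -- At the endpoint the curve meets `S`, which leaves the term `arccos c`.
  have h2 : f 1 = 1 := fidelity_self hS (γ 1).2.2
  have h3 : ENNReal.ofReal (Real.arccos (c * f 0) - Real.arccos c) ≤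
      ‖Real.arccos (c * f 1) - Real.arccos (c * f 0)‖ₑ := by
    rw [h2, mul_one, Real.enorm_eq_ofReal_abs, abs_sub_comm]
    exact ENNReal.ofReal_le_ofReal (le_abs_self _)
  refine h3.trans (h1.trans ?_)
  rw [pathELength_eq_lintegral_mfderiv_Icc]
  refine lintegral_mono fun t => ?_
  rw [enorm_tangent, mfderiv_apply_one (hγ.mdifferentiable one_ne_zero t),
    Real.enorm_eq_ofReal_abs]
  refine ENNReal.ofReal_le_ofReal ?_
  set v := deriv (chartMap ∘ γ) t
  have hd := deriv_val_comp (hx.differentiable one_ne_zero t)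
  refine abs_deriv_arccos_le (hf.differentiable one_ne_zero t) hc (hf1 t)
    (bwForm_nonneg (γ t).2.1 v.isHermitian) ?_
  rw [hfdef, deriv_fidelity_comp hA (fun t => (γ t).2.1) hS, hd.deriv]
  exact sq_half_re_trace_optMap_mul_le (γ t).2.1 hS (γ t).2.2 (γ 1).2.2 v.isHermitian
    v.trace_eq_zero

theorem ofReal_arccos_fidelity_le_riemannianEDist (ρ₁ ρ₂ : DensityMatrix n) :
    ENNReal.ofReal (Real.arccos (fidelity ρ₁.1 ρ₂.1)) ≤
      riemannianEDist 𝓘(ℝ, TracelessHermitian n) ρ₁ ρ₂ := by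
  refine le_of_forall_gt fun r hr => ?_
  -- The competitor obtained here is `C¹` on all of `ℝ`, so one-sided derivatives at the endpoints
  -- never arise.
  obtain ⟨γ, h0, h1, hγ, hlt, -, -⟩ :=
    exists_lt_locally_constant_of_riemannianEDist_lt hr (zero_lt_one (α := ℝ))
  refine lt_of_le_of_lt ?_ hlt
  -- Letting `c` tend to `1` from below removes the regularization, as `arccos 1 = 0`.
  have hlim : Filter.Tendsto (fun c : ℝ => ENNReal.ofReal
      (Real.arccos (c * fidelity ρ₁.1 ρ₂.1) - Real.arccos c)) (𝓝[<] 1)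
      (𝓝 (ENNReal.ofReal (Real.arccos (fidelity ρ₁.1 ρ₂.1)))) := by
    have hcont : Continuous fun c : ℝ => ENNReal.ofReal
        (Real.arccos (c * fidelity ρ₁.1 ρ₂.1) - Real.arccos c) :=
      ENNReal.continuous_ofReal.comp ((Real.continuous_arccos.comp
        (continuous_id.mul continuous_const)).sub Real.continuous_arccos)
    have := hcont.tendsto 1
    simp only [one_mul, Real.arccos_one, sub_zero] at this
    exact this.mono_left nhdsWithin_le_nhds
  refine le_of_tendsto hlim ?_
  filter_upwards [Ioo_mem_nhdsLT (zero_lt_one (α := ℝ))] with c hc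
  have := ofReal_arccos_sub_le_pathELength hγ (c := c) (by nlinarith [hc.1, hc.2])
  rwa [h0, h1] at this

end LowerBound

/-! ### Geodesics and the upper bound for the distance -/

section UpperBound

open Matrix MeasureTheory Set
open scoped Topology

variable {n : ℕ} {R S V : Matrix (Fin n) (Fin n) ℂ}

/-- Here `1` and `V` are orthonormal. With coefficients `(cos t, sin t)` this gives the trace of the
geodesic, with `(-sin t, cos t)` its squared speed. -/
lemma re_trace_smul_add_smul (hR1 : R.trace = 1) (h1 : (trace (V * R)).re = 0)
    (h2 : (trace (V * R * V)).re = 1) (a b : ℝ) :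
    (trace ((a • (1 : Matrix (Fin n) (Fin n) ℂ) + b • V) * R *
      (a • (1 : Matrix (Fin n) (Fin n) ℂ) + b • V))).re = a ^ 2 + b ^ 2 := by
  have h3 : (trace (R * V)).re = 0 := by rw [trace_mul_comm, h1]
  simp only [add_mul, mul_add, smul_mul_assoc, mul_smul_comm, trace_add, trace_smul, mul_one,
    one_mul, Complex.add_re, Complex.smul_re, smul_eq_mul, h1, h2, h3, hR1, Complex.one_re]
  ring

lemma trace_eq_one_of_re (hR : R.PosSemidef) (h : R.trace.re = 1) : R.trace = 1 :=
  Complex.ext h (Complex.le_def.1 hR.trace_nonneg).2.symm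

/-- The initial velocity, up to multiplication by the square root of `R`, of the unit speed
geodesic from `R` to `S`. -/
noncomputable def geodesicDir (R S : Matrix (Fin n) (Fin n) ℂ) : Matrix (Fin n) (Fin n) ℂ :=
  (Real.sin (Real.arccos (fidelity R S)))⁻¹ • (optMap R S - fidelity R S • 1)

/-- The matrices `W` for which `W R W` runs through the geodesic from `R` to `S`. -/
noncomputable def geodesicMap (R S : Matrix (Fin n) (Fin n) ℂ) (t : ℝ) :
    Matrix (Fin n) (Fin n) ℂ :=
  Real.cos t • 1 + Real.sin t • geodesicDir R S

section Geodesic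

variable (hR : R.PosDef) (hS : S.PosDef) (hR1 : R.trace = 1) (hS1 : S.trace = 1)
  (hne : fidelity R S < 1)

include hne in
lemma sin_arccos_fidelity_pos : 0 < Real.sin (Real.arccos (fidelity R S)) := by
  apply Real.sin_pos_of_pos_of_lt_pi (Real.arccos_pos.2 hne)
  have := Real.arccos_le_pi_div_two.2 (fidelity_nonneg R S)
  linarith [Real.pi_pos]

include hne in
lemma cos_arccos_fidelity : Real.cos (Real.arccos (fidelity R S)) = fidelity R S :=
  Real.cos_arccos (by linarith [fidelity_nonneg R S]) hne.le

include hR hS hR1 in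
lemma re_trace_geodesicDir_mul : (trace (geodesicDir R S * R)).re = 0 := by
  simp [geodesicDir, sub_mul, re_trace_optMap_mul hR hS, hR1]

include hR hS hR1 hS1 hne in
lemma re_trace_geodesicDir_mul_mul :
    (trace (geodesicDir R S * R * geodesicDir R S)).re = 1 := by
  have h := sin_arccos_fidelity_pos hne
  have h1 := cos_arccos_fidelity hne
  simp only [geodesicDir, smul_mul_assoc, mul_smul_comm, trace_smul, Complex.smul_re, smul_eq_mul,
    re_trace_optMap_sub hR hS hR1 hS1]
  set θ := Real.arccos (fidelity R S)
  rw [← h1, ← Real.sin_sq]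
  field_simp

include hne in
-- Spherical interpolation between `1` and `optMap R S`. Unlike `geodesicDir R S`, which need not be
-- positive, both matrices here are positive definite and the coefficients are nonnegative on the
-- arc.
lemma geodesicMap_eq (t : ℝ) : geodesicMap R S t =
    (Real.sin (Real.arccos (fidelity R S) - t) / Real.sin (Real.arccos (fidelity R S))) • 1 +
      (Real.sin t / Real.sin (Real.arccos (fidelity R S))) • optMap R S := by
  have h := sin_arccos_fidelity_pos hne
  have h1 := cos_arccos_fidelity hne
  rw [geodesicMap, geodesicDir, Real.sin_sub, h1, smul_smul, smul_sub, smul_smul, sub_div,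
    mul_div_cancel_left₀ _ h.ne', sub_smul]
  have h2 : Real.sin t * (Real.sin (Real.arccos (fidelity R S)))⁻¹ * fidelity R S =
      fidelity R S * Real.sin t / Real.sin (Real.arccos (fidelity R S)) := by
    field_simp
  rw [h2, div_eq_mul_inv (Real.sin t)]
  abel

include hne in
lemma geodesicMap_arccos : geodesicMap R S (Real.arccos (fidelity R S)) = optMap R S := by
  rw [geodesicMap_eq hne, sub_self, Real.sin_zero, zero_div, zero_smul, zero_add,
    div_self (sin_arccos_fidelity_pos hne).ne', one_smul]

include hR hS hne in
lemma geodesicMap_posDef {t : ℝ} (ht : t ∈ Icc 0 (Real.arccos (fidelity R S))) :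
    (geodesicMap R S t).PosDef := by
  -- At the right end the coefficient of `1` vanishes and definiteness comes from `optMap R S`;
  -- before it, the positive multiple of `1` suffices.
  rcases ht.2.eq_or_lt with rfl | hlt
  · rw [geodesicMap_arccos hne]
    exact optMap_posDef hR hS
  rw [geodesicMap_eq hne]
  have hθ := Real.arccos_le_pi (fidelity R S)
  have h := sin_arccos_fidelity_pos hne
  have ha := Real.sin_pos_of_pos_of_lt_pi (x := Real.arccos (fidelity R S) - t)
    (sub_pos.2 hlt) (by linarith [ht.1, Real.arccos_le_pi_div_two.2 (fidelity_nonneg R S),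
      Real.pi_pos])
  exact (PosDef.one.smul (div_pos ha h)).add_posSemidef
    ((optMap_posDef hR hS).posSemidef.smul
      (div_nonneg (Real.sin_nonneg_of_nonneg_of_le_pi ht.1 (by linarith)) h.le))

include hR hS hR1 hS1 hne in
lemma trace_geodesic {t : ℝ} (ht : t ∈ Icc 0 (Real.arccos (fidelity R S))) :
    trace (geodesicMap R S t * R * geodesicMap R S t) = 1 := by
  refine trace_eq_one_of_re (mul_mul_posDef hR (geodesicMap_posDef hR hS hne ht)).posSemidef ?_
  rw [geodesicMap, re_trace_smul_add_smul hR1 (re_trace_geodesicDir_mul hR hS hR1)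
    (re_trace_geodesicDir_mul_mul hR hS hR1 hS1 hne), Real.cos_sq_add_sin_sq]

open scoped Matrix.Norms.L2Operator

lemma contDiff_geodesic :
    ContDiff ℝ 1 fun t => geodesicMap R S t * R * geodesicMap R S t := by
  have h : ContDiff ℝ 1 (geodesicMap R S) :=
    (Real.contDiff_cos.smul contDiff_const).add (Real.contDiff_sin.smul contDiff_const)
  exact (h.mul contDiff_const).mul h

include hR hS hR1 hS1 hne in
lemma bwForm_deriv_geodesic {t : ℝ} (ht : t ∈ Icc 0 (Real.arccos (fidelity R S))) :
    bwForm (geodesicMap R S t * R * geodesicMap R S t)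
      (deriv (fun t => geodesicMap R S t * R * geodesicMap R S t) t)
      (deriv (fun t => geodesicMap R S t * R * geodesicMap R S t) t) = 1 := by
  let D : Matrix (Fin n) (Fin n) ℂ := (-Real.sin t) • 1 + Real.cos t • geodesicDir R S
  have hD : HasDerivAt (geodesicMap R S) D t :=
    ((Real.hasDerivAt_cos t).smul_const _).add ((Real.hasDerivAt_sin t).smul_const _)
  have h1 : HasDerivAt (fun t => geodesicMap R S t * R * geodesicMap R S t)
      (D * R * geodesicMap R S t + geodesicMap R S t * R * D) t := (hD.mul_const R).mul hD
  have hW := geodesicMap_posDef hR hS hne ht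
  -- Both are real combinations of `1` and `geodesicDir R S`.
  have hc : Commute (geodesicMap R S t) D := by
    have h2 : Commute (geodesicMap R S t) (geodesicDir R S) :=
      ((Commute.one_left _).smul_left _).add_left ((Commute.refl _).smul_left _)
    exact ((Commute.one_right _).smul_right _).add_right (h2.smul_right _)
  rw [h1.deriv, bwForm_mul_mul hW (mul_mul_posDef hR hW) hc,
    re_trace_smul_add_smul hR1 (re_trace_geodesicDir_mul hR hS hR1)
    (re_trace_geodesicDir_mul_mul hR hS hR1 hS1 hne), neg_sq, Real.sin_sq_add_cos_sq]

end Geodesic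

open scoped Matrix.Norms.L2Operator

/-! ### The geodesic as a curve of density matrices. -/

lemma contDiffOn_chartMap_comp [NeZero n] {γ : ℝ → DensityMatrix n} {s : Set ℝ}
    (hγ : ContDiffOn ℝ 1 (fun t => (γ t).1) s) : ContDiffOn ℝ 1 (chartMap ∘ γ) s := by
  obtain ⟨P, hP⟩ := (TracelessHermitian.toMatrix (n := n)).exists_leftInverse_of_injective
    (LinearMap.ker_eq_bot.2 TracelessHermitian.toMatrix_injective)
  have h : chartMap ∘ γ = fun t => P.toContinuousLinearMap ((γ t).1 - center n) := by
    ext1 t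
    exact (LinearMap.congr_fun hP (chartMap (γ t))).symm
  rw [h]
  exact P.toContinuousLinearMap.contDiff.comp_contDiffOn (hγ.sub contDiffOn_const)

open Classical in
theorem riemannianEDist_le_ofReal_arccos_fidelity [NeZero n] (ρ₁ ρ₂ : DensityMatrix n) :
    riemannianEDist 𝓘(ℝ, TracelessHermitian n) ρ₁ ρ₂ ≤
      ENNReal.ofReal (Real.arccos (fidelity ρ₁.1 ρ₂.1)) := by
  obtain ⟨R, hR, hR1⟩ := ρ₁
  obtain ⟨S, hS, hS1⟩ := ρ₂
  -- Fidelity one is separate because the normalization of `geodesicDir` would divide by `sin 0`;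
  -- the two points then coincide.
  rcases (fidelity_le_one hR hS hR1 hS1).eq_or_lt with h | hne
  · obtain rfl := eq_of_fidelity_eq_one hR hS hR1 hS1 h
    rw [riemannianEDist_self]
    exact zero_le
  change _ ≤ ENNReal.ofReal (Real.arccos (fidelity R S))
  set θ := Real.arccos (fidelity R S) with hθ
  let G : ℝ → Matrix (Fin n) (Fin n) ℂ := fun t => geodesicMap R S t * R * geodesicMap R S t
  -- Positivity of `G t` is only known on `[0, θ]`; the fallback value elsewhere plays no role.
  let γ : ℝ → DensityMatrix n := fun t =>
    if h : (G t).PosDef ∧ (G t).trace = 1 then ⟨G t, h⟩ else ⟨R, hR, hR1⟩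
  have hγG : ∀ t ∈ Icc 0 θ, (γ t).1 = G t := fun t ht => by
    have h : (G t).PosDef ∧ (G t).trace = 1 :=
      ⟨mul_mul_posDef hR (geodesicMap_posDef hR hS hne ht), trace_geodesic hR hS hR1 hS1 hne ht⟩
    simp only [γ, dif_pos h]
  have hθ0 : 0 ≤ θ := Real.arccos_nonneg _
  have hx : ContDiffOn ℝ 1 (chartMap ∘ γ) (Icc 0 θ) :=
    contDiffOn_chartMap_comp (contDiff_geodesic.contDiffOn.congr hγG)
  have hγ := contMDiffOn_of_contDiffOn_chartMap_comp hx
  have h0 : γ 0 = ⟨R, hR, hR1⟩ := Subtype.ext <| by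
    rw [hγG 0 ⟨le_rfl, hθ0⟩]
    simp [G, geodesicMap]
  have h1 : γ θ = ⟨S, hS, hS1⟩ := Subtype.ext <| by
    rw [hγG θ ⟨hθ0, le_rfl⟩]
    simp only [G, hθ, geodesicMap_arccos hne, optMap_mul_mul_optMap hR hS]
  refine (riemannianEDist_le_pathELength hγ h0 h1 hθ0).trans_eq ?_
  -- The endpoints are dropped because `γ` may fail to be differentiable there; inside, it agrees
  -- with `G` near each point.
  rw [pathELength_eq_lintegral_mfderiv_Ioo]
  have hone : ∀ t ∈ Ioo 0 θ,
      ‖mfderiv 𝓘(ℝ, ℝ) 𝓘(ℝ, TracelessHermitian n) γ t 1‖ₑ = 1 := by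
    intro t ht
    have hnhds : Icc 0 θ ∈ 𝓝 t := Icc_mem_nhds ht.1 ht.2
    have htI := Ioo_subset_Icc_self ht
    have hd := deriv_val_comp ((hx.contDiffAt hnhds).differentiableAt one_ne_zero)
    have hev : (fun t => (γ t).1) =ᶠ[𝓝 t] G := Filter.eventually_of_mem hnhds hγG
    have hderiv := (hd.congr_of_eventuallyEq hev.symm).deriv
    rw [enorm_tangent, mfderiv_apply_one
      ((hγ.contMDiffAt hnhds).mdifferentiableAt one_ne_zero), hγG t htI]
    refine (congrArg (fun H => ENNReal.ofReal (√(bwForm (G t) H H))) hderiv.symm).trans ?_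
    simp only [G, bwForm_deriv_geodesic hR hS hR1 hS1 hne htI, Real.sqrt_one, ENNReal.ofReal_one]
  rw [setLIntegral_congr_fun measurableSet_Ioo hone]
  simp

end UpperBound

end BuresWasserstein


theorem mainTheorem3 (n : ℕ) [NeZero n] (ρ₁ ρ₂ : DensityMatrix n) :
    riemannianEDist 𝓘(ℝ, TracelessHermitian n) ρ₁ ρ₂ =
      ENNReal.ofReal (Real.arccos
        (Matrix.trace (CFC.sqrt (CFC.sqrt ρ₂.1 * ρ₁.1 * CFC.sqrt ρ₂.1))).re) :=
  le_antisymm (riemannianEDist_le_ofReal_arccos_fidelity ρ₁ ρ₂)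
    (ofReal_arccos_fidelity_le_riemannianEDist ρ₁ ρ₂)
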